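/- Let $\Omega=\{x\in\mathbb R^2 : |x|<1\}$, let $0<\alpha<\frac{\pi}{2}$, and let $I=[\frac{\pi}{2}-\alpha,\frac{\pi}{2}+\alpha]$, regarded as an arc of $\partial\Omega$ through the angular coordinate $\phi$. For a real function $f$ on $I$ let $f^e$ be its extension by zero to $\partial\Omega$. Call $f$ admissible if $f^e\in H^{1/2}(\partial\Omega)$, and in that case let $u_f\in H^1(\Omega)$ be the weak solution of $$\Delta u_f=0 \ \text{ in } \Omega,\qquad u_f=f^e \ \text{ on } \partial\Omega .$$ For real-valued $\gamma\in L^2(\Omega)$, the linearized incomplete Dirichlet-to-Neumann map of $\gamma$ (at the constant conductivity $1$) is given by $$\langle \Lambda_\gamma' f,g\rangle=\int_\Omega \gamma\,\nabla u_f\cdot\nabla u_g\,dx$$ for all admissible $f,g$ for which this integral converges absolutely. Let $\gamma_1,\gamma_2\in L^2(\Omega)$ be real-valued, and suppose that each of them vanishes almost everywhere in the intersection of $\Omega$ with some neighborhood of the two endpoints $e^{i(\pi/2\pm\alpha)}$ of $I$. If $$\langle \Lambda_{\gamma_1}' f,g\rangle=\langle \Lambda_{\gamma_2}' f,g\rangle$$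 for all admissible $f,g$ for which both sides are defined, then $\gamma_1=\gamma_2$ almost everywhere in $\Omega$. That is, such a $\gamma$ is uniquely determined by its linearized incomplete Dirichlet-to-Neumann map. -/

import Mathlib

/-!
Linearized electrical impedance tomography on the unit disk with data on an arc.

The plane `ℝ²` is identified with `ℂ` (as a real inner product space with Lebesgue measure), so
that a planar vector field is a function `ℂ → ℂ` and `inner ℝ` is the Euclidean scalar product.
The boundary circle is parametrized by the angle `φ ∈ (-π, π]` through `φ ↦ exp (i φ)`; arc length
is then Lebesgue measure on `(-π, π]`, and a function on the circle is a function of `φ`.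
-/

noncomputable section

namespace LinearizedEIT

open MeasureTheory Filter Topology Set
open scoped ContDiff

/-- The open unit disk. -/
def disk : Set ℂ := Metric.ball 0 1

/-- Lebesgue measure on the unit disk. -/
def diskMeasure : Measure ℂ := volume.restrict disk

/-- Arc length on the unit circle, in the angular coordinate `φ ∈ (-π, π]`. -/
def circleMeasure : Measure ℝ := volume.restrict (Ioc (-Real.pi) Real.pi)

/-- The point of the unit circle with angle `φ`. -/
def circlePoint (φ : ℝ) : ℂ := Complex.exp (φ * Complex.I)

/-- Test functions on the disk: smooth, with compact support contained in the open disk. -/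
def IsTestFunction (η : ℂ → ℝ) : Prop :=
  ContDiff ℝ ∞ η ∧ HasCompactSupport η ∧ tsupport η ⊆ disk

/-- `G` is the weak gradient of `u` in the disk. -/
def IsWeakGradient (u : ℂ → ℝ) (G : ℂ → ℂ) : Prop :=
  ∀ η : ℂ → ℝ, IsTestFunction η →
    ∫ z, u z • gradient η z ∂diskMeasure = -∫ z, η z • G z ∂diskMeasure

/-- `u` belongs to the Sobolev space `H¹` of the disk, with weak gradient `G`. -/
structure MemH1 (u : ℂ → ℝ) (G : ℂ → ℂ) : Prop where
  memLp_fun : MemLp u 2 diskMeasure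
  memLp_grad : MemLp G 2 diskMeasure
  weakGradient : IsWeakGradient u G

/-- `w` is smooth up to the boundary of the disk: smooth on a neighbourhood of the closed disk. -/
def SmoothOnClosedDisk (w : ℂ → ℝ) : Prop :=
  ∃ U : Set ℂ, IsOpen U ∧ Metric.closedBall 0 1 ⊆ U ∧ ContDiffOn ℝ ∞ w U

/-- The `H¹` function `u`, with weak gradient `G`, has boundary trace `h`. The trace operator is
the continuous extension to `H¹` of the restriction to the circle, so this says that functions
that are smooth up to the boundary converge to `u` in `H¹` while their restrictions to the circle
converge to `h` in `L²` of the circle. -/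
def HasTrace (u : ℂ → ℝ) (G : ℂ → ℂ) (h : ℝ → ℝ) : Prop :=
  ∃ w : ℕ → ℂ → ℝ, (∀ k, SmoothOnClosedDisk (w k)) ∧
    Tendsto (fun k => eLpNorm (fun z => w k z - u z) 2 diskMeasure) atTop (𝓝 0) ∧
    Tendsto (fun k => eLpNorm (fun z => gradient (w k) z - G z) 2 diskMeasure) atTop (𝓝 0) ∧
    Tendsto (fun k => eLpNorm (fun φ => w k (circlePoint φ) - h φ) 2 circleMeasure) atTop (𝓝 0)

/-- The space `H^{1/2}` of the unit circle: the `L²` functions on the circle that are boundary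
traces of `H¹` functions on the disk. -/
def MemHHalf (h : ℝ → ℝ) : Prop :=
  MemLp h 2 circleMeasure ∧ ∃ (u : ℂ → ℝ) (G : ℂ → ℂ), MemH1 u G ∧ HasTrace u G h

/-- `u`, with weak gradient `G`, is the weak solution in `H¹` of the Dirichlet problem
`Δ u = 0` in the disk, `u = h` on the circle. -/
structure IsDirichletSolution (h : ℝ → ℝ) (u : ℂ → ℝ) (G : ℂ → ℂ) : Prop where
  memH1 : MemH1 u G
  harmonic : ∀ η : ℂ → ℝ, IsTestFunction η → ∫ z, inner ℝ (G z) (gradient η z) ∂diskMeasure = 0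
  trace : HasTrace u G h

/-- The arc `I = [π/2 - α, π/2 + α]` of angles on which the data are given. -/
def arc (α : ℝ) : Set ℝ := Icc (Real.pi / 2 - α) (Real.pi / 2 + α)

/-- The extension `fᵉ` of boundary data `f` on the arc by zero to the whole circle. -/
def zeroExt (α : ℝ) (f : ℝ → ℝ) : ℝ → ℝ := (arc α).indicator f

/-- The linearized incomplete Dirichlet-to-Neumann form of `γ` is defined at the pair `(f, g)` of
boundary data on the arc and takes the value `c` there: `fᵉ` and `gᵉ` are in `H^{1/2}`, and `c` is
the absolutely convergent integral of `γ ∇u · ∇v` over the disk, where `u` and `v` are the harmonic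
functions with boundary values `fᵉ` and `gᵉ`. -/
def HasLinearizedDtNValue (α : ℝ) (γ : ℂ → ℝ) (f g : ℝ → ℝ) (c : ℝ) : Prop :=
  MemHHalf (zeroExt α f) ∧ MemHHalf (zeroExt α g) ∧
    ∃ (u : ℂ → ℝ) (G : ℂ → ℂ) (v : ℂ → ℝ) (H : ℂ → ℂ),
      IsDirichletSolution (zeroExt α f) u G ∧ IsDirichletSolution (zeroExt α g) v H ∧
      Integrable (fun z => γ z * inner ℝ (G z) (H z)) diskMeasure ∧
      c = ∫ z, γ z * inner ℝ (G z) (H z) ∂diskMeasure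

/-- `γ` vanishes (almost everywhere) in a neighbourhood of each endpoint of the arc. -/
def VanishesNearEndpoints (α : ℝ) (γ : ℂ → ℝ) : Prop :=
  (∃ U ∈ 𝓝 (circlePoint (Real.pi / 2 - α)), ∀ᵐ z ∂diskMeasure, z ∈ U → γ z = 0) ∧
    ∃ U ∈ 𝓝 (circlePoint (Real.pi / 2 + α)), ∀ᵐ z ∂diskMeasure, z ∈ U → γ z = 0

end LinearizedEIT

end

noncomputable section

namespace LinearizedEIT

open MeasureTheory Filter Topology Set
open scoped ContDiff ComplexConjugate

/-! The data are tested on explicit harmonic functions, imaginary parts of polynomials in one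
conformal coordinate `p`. With `R` and `L` the square roots of the factors vanishing at the right
and left endpoints (`L` rotated by `exp (i α / 2)`), `L² / R²` is a Möbius map of the disk onto the
upper half-plane, positive on the circle off the arc. Hence `L / R` maps into the first quadrant,
and `p = L / (R + L)` into the upper half of the disk with diameter `[0, 1]`, real off the arc.

Real polynomials in `p` therefore have imaginary parts vanishing off the arc. The derivative `p'` is
singular at the endpoints, where `p` is `0` or `1`, but `K = p (1 - p) p'` is bounded and has no
zeros (`hasDerivAt_coord`). Primitives of `p ^ m * K` are polynomials in `p`, and their imaginary
parts are solutions with bounded gradient, so every pairing with an `L²` function converges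
(`isDirichletSolution_potential`).

The scalar product of two such gradients is `|K|² re (p ^ m * conj p ^ n)`. Equal data thus make all
moments of `(γ₁ - γ₂) |K|²` against these real parts vanish. They span the algebra generated by `re
p` and `|p|²`, which separates points of the disk because `p` is injective and never takes conjugate
values (`coord_injOn`, `coord_ne_conj_coord`). A Stone–Weierstrass argument for measures
(`ae_eq_zero_of_moments`) then gives `(γ₁ - γ₂) |K|² = 0`, and `K ≠ 0` finishes. -/

theorem measurableSet_disk : MeasurableSet disk := Metric.isOpen_ball.measurableSet

theorem isOpen_disk : IsOpen disk := Metric.isOpen_ball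

instance : IsFiniteMeasure diskMeasure :=
  ⟨by
    rw [diskMeasure, Measure.restrict_apply_univ]
    exact measure_ball_lt_top⟩

instance : IsFiniteMeasure circleMeasure :=
  ⟨by
    rw [circleMeasure, Measure.restrict_apply_univ]
    exact measure_Ioc_lt_top⟩

/-! ### Bounded convergence and integration by parts -/

/-- Bounded convergence in `L²` of a finite measure. -/
theorem tendsto_eLpNorm_two_of_bounded {X E : Type*} [MeasurableSpace X] [NormedAddCommGroup E]
    {μ : Measure X} [IsFiniteMeasure μ] {F : ℕ → X → E} {C : ℝ}
    (hm : ∀ k, AEStronglyMeasurable (F k) μ) (hb : ∀ k, ∀ᵐ x ∂μ, ‖F k x‖ ≤ C)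
    (hl : ∀ᵐ x ∂μ, Tendsto (fun k => F k x) atTop (𝓝 0)) :
    Tendsto (fun k => eLpNorm (F k) 2 μ) atTop (𝓝 0) := by
  have h2 : Tendsto (fun k => ∫⁻ x, ‖F k x‖ₑ ^ (2 : ℝ) ∂μ) atTop (𝓝 (∫⁻ _, 0 ∂μ)) := by
    refine tendsto_lintegral_of_dominated_convergence' (fun _ => ENNReal.ofReal C ^ (2 : ℝ))
      (fun k => (hm k).enorm.pow_const _) (fun k => ?_) ?_ ?_
    · filter_upwards [hb k] with x hx
      refine ENNReal.rpow_le_rpow ?_ (by norm_num)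
      rw [← ofReal_norm]
      exact ENNReal.ofReal_le_ofReal hx
    · rw [lintegral_const]
      exact ENNReal.mul_ne_top (ENNReal.rpow_ne_top_of_nonneg (by norm_num) ENNReal.ofReal_ne_top)
        (measure_ne_top _ _)
    · filter_upwards [hl] with x hx
      have := ((ENNReal.continuous_rpow_const (y := (2 : ℝ))).tendsto _).comp
        ((continuous_enorm.tendsto (0 : E)).comp hx)
      simpa [Function.comp_def] using this
  have h3 := ((ENNReal.continuous_rpow_const (y := (1 / 2 : ℝ))).tendsto _).comp h2
  simp only [lintegral_zero] at h3
  rw [ENNReal.zero_rpow_of_pos (by norm_num)] at h3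
  refine h3.congr fun k => ?_
  rw [eLpNorm_eq_lintegral_rpow_enorm_toReal (by norm_num) (by norm_num)]
  simp

theorem IsTestFunction.eq_zero {η : ℂ → ℝ} (hη : IsTestFunction η) {z : ℂ} (hz : z ∉ disk) :
    η z = 0 := image_eq_zero_of_notMem_tsupport fun h => hz (hη.2.2 h)

theorem IsTestFunction.fderiv_eq_zero {η : ℂ → ℝ} (hη : IsTestFunction η) {z : ℂ}
    (hz : z ∉ disk) : fderiv ℝ η z = 0 :=
  image_eq_zero_of_notMem_tsupport fun h => hz (hη.2.2 (tsupport_fderiv_subset ℝ h))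

/-- A function that is continuous on the disk becomes integrable after multiplication by a
continuous function with compact support in the disk. -/
theorem integrable_mul_of_continuousOn {a η : ℂ → ℝ} (ha : ContinuousOn a disk)
    (hη : Continuous η) (hc : HasCompactSupport η) (hs : tsupport η ⊆ disk) :
    Integrable (fun z => a z * η z) := by
  have hsupp : tsupport (fun z => a z * η z) ⊆ tsupport η := tsupport_mul_subset_right
  refine Continuous.integrable_of_hasCompactSupport ?_ (hc.mono' (subset_trans subset_closure hsupp))
  refine continuous_of_tsupport fun x hx => ?_
  exact (ha.continuousAt (isOpen_disk.mem_nhds (hs (hsupp hx)))).mul hη.continuousAt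

/-- Integration by parts against a test function on the disk. -/
theorem integral_mul_fderiv_testFunction {a b η : ℂ → ℝ} {v : ℂ} (hη : IsTestFunction η)
    (hd : ∀ z ∈ disk, DifferentiableAt ℝ a z) (hb : ∀ z ∈ disk, fderiv ℝ a z v = b z)
    (hbc : ContinuousOn b disk) :
    ∫ z, a z * fderiv ℝ η z v ∂diskMeasure = -∫ z, b z * η z ∂diskMeasure := by
  obtain ⟨h1, h2, h3⟩ := hη
  have hac : ContinuousOn a disk := fun z hz => (hd z hz).continuousAt.continuousWithinAt
  have hz : ∀ z ∉ disk, η z = 0 := fun z hz => IsTestFunction.eq_zero ⟨h1, h2, h3⟩ hz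
  have hz' : ∀ z ∉ disk, fderiv ℝ η z = 0 := fun z hz => IsTestFunction.fderiv_eq_zero ⟨h1, h2, h3⟩ hz
  -- Outside the disk `fderiv ℝ a` is arbitrary, but there `η` vanishes; so the integration by parts
  -- can be done on the whole plane.
  have hbe : ∀ z, fderiv ℝ a z v * η z = b z * η z := fun z => by
    by_cases h : z ∈ disk
    · rw [hb z h]
    · simp [hz z h]
  have hη' : Continuous fun z => fderiv ℝ η z v :=
    (h1.continuous_fderiv (by simp)).clm_apply continuous_const
  have hs' : tsupport (fun z => fderiv ℝ η z v) ⊆ tsupport η := tsupport_fderiv_apply_subset ℝ v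
  have key := integral_mul_fderiv_eq_neg_fderiv_mul_of_integrable (μ := volume) (f := a) (g := η)
    (v := v) (by simpa only [hbe] using integrable_mul_of_continuousOn hbc h1.continuous h2 h3)
    (integrable_mul_of_continuousOn hac hη' (h2.fderiv_apply (𝕜 := ℝ) v) (hs'.trans h3))
    (integrable_mul_of_continuousOn hac h1.continuous h2 h3)
    (fun z hz => hd z (h3 hz)) (fun z _ => (h1.differentiable (by simp)) z)
  simp only [hbe] at key
  rw [diskMeasure, setIntegral_eq_integral_of_forall_compl_eq_zero,
    setIntegral_eq_integral_of_forall_compl_eq_zero, key]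
  · intro z h; simp [hz z h]
  · intro z h; simp [hz' z h]

/-! ### Imaginary parts of holomorphic functions as weak solutions -/

/-- The gradient of the imaginary part of a holomorphic function. -/
theorem hasGradientAt_im {f : ℂ → ℂ} {f' z : ℂ} (h : HasDerivAt f f' z) :
    HasGradientAt (fun z => (f z).im) (Complex.I * conj f') z := by
  rw [hasGradientAt_iff_hasFDerivAt]
  have := Complex.imCLM.hasFDerivAt.comp z (h.hasFDerivAt.restrictScalars ℝ)
  refine this.congr_fderiv ?_
  ext
  simp [Complex.inner, Complex.mul_re]
  ring

theorem fderiv_im {f : ℂ → ℂ} {f' z : ℂ} (h : HasDerivAt f f' z) (v : ℂ) :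
    fderiv ℝ (fun z => (f z).im) z v = (v * f').im := by
  have := (Complex.imCLM.hasFDerivAt.comp z (h.hasFDerivAt.restrictScalars ℝ)).fderiv
  simp only [Function.comp_def, Complex.imCLM_apply] at this
  rw [this]
  simp

theorem fderiv_re {f : ℂ → ℂ} {f' z : ℂ} (h : HasDerivAt f f' z) (v : ℂ) :
    fderiv ℝ (fun z => (f z).re) z v = (v * f').re := by
  have := (Complex.reCLM.hasFDerivAt.comp z (h.hasFDerivAt.restrictScalars ℝ)).fderiv
  simp only [Function.comp_def, Complex.reCLM_apply] at this
  rw [this]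
  simp

theorem gradient_eq_fderiv (η : ℂ → ℝ) (z : ℂ) :
    gradient η z = ⟨fderiv ℝ η z 1, fderiv ℝ η z Complex.I⟩ := by
  have h1 := inner_gradient_left (𝕜 := ℝ) (f := η) (x := z) (y := 1)
  have h2 := inner_gradient_left (𝕜 := ℝ) (f := η) (x := z) (y := Complex.I)
  simp only [Complex.inner] at h1 h2
  apply Complex.ext
  · simpa using h1
  · simpa using h2

theorem IsTestFunction.continuous_gradient {η : ℂ → ℝ} (hη : IsTestFunction η) :
    Continuous (gradient η) :=
  (InnerProductSpace.toDual ℝ ℂ).symm.continuous.comp (hη.1.continuous_fderiv (by simp))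

theorem IsTestFunction.hasCompactSupport_gradient {η : ℂ → ℝ} (hη : IsTestFunction η) :
    HasCompactSupport (gradient η) :=
  (hη.2.1.fderiv (𝕜 := ℝ)).comp_left (g := (InnerProductSpace.toDual ℝ ℂ).symm) (map_zero _)

/-- The imaginary part of a holomorphic function that is continuous on the closed disk and has
bounded derivative is the weak solution of the Dirichlet problem with its boundary values. -/
theorem isDirichletSolution_im {f f' : ℂ → ℂ} {C : ℝ} {h : ℝ → ℝ}
    (hf : ∀ z ∈ disk, HasDerivAt f (f' z) z) (hfc : ContinuousOn f (Metric.closedBall 0 1))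
    (hb : ∀ z ∈ disk, ‖f' z‖ ≤ C)
    (hh : ∀ φ ∈ Ioc (-Real.pi) Real.pi, h φ = (f (circlePoint φ)).im) :
    IsDirichletSolution h (fun z => (f z).im) (fun z => Complex.I * conj (f' z)) := by
  have hfd : DifferentiableOn ℂ f disk := fun z hz =>
    (hf z hz).differentiableAt.differentiableWithinAt
  have hf' : ∀ z ∈ disk, HasDerivAt f' (deriv f' z) z := fun z hz => by
    have h1 : DifferentiableOn ℂ f' disk :=
      (hfd.deriv isOpen_disk).congr fun w hw => (hf w hw).deriv.symm
    exact (h1.differentiableAt (isOpen_disk.mem_nhds hz)).hasDerivAt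
  have hf'd : DifferentiableOn ℂ f' disk := fun z hz =>
    (hf' z hz).differentiableAt.differentiableWithinAt
  have hf''c : ContinuousOn (deriv f') disk := (hf'd.deriv isOpen_disk).continuousOn
  obtain ⟨B, hB⟩ := (isCompact_closedBall (0 : ℂ) 1).exists_bound_of_continuousOn hfc
  have hsub : disk ⊆ Metric.closedBall 0 1 := Metric.ball_subset_closedBall
  have hC : 0 ≤ C := (norm_nonneg _).trans (hb 0 (by simp [disk]))
  have hae : ∀ {P : ℂ → Prop}, (∀ z ∈ disk, P z) → ∀ᵐ z ∂diskMeasure, P z := fun hP =>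
    (ae_restrict_iff' measurableSet_disk).2 (ae_of_all _ hP)
  have hm : ∀ {E : Type} [NormedAddCommGroup E] {g : ℂ → E}, ContinuousOn g disk →
      AEStronglyMeasurable g diskMeasure := fun hg => hg.aestronglyMeasurable measurableSet_disk
  have hGc : ContinuousOn (fun z => Complex.I * conj (f' z)) disk :=
    continuousOn_const.mul (Complex.continuous_conj.comp_continuousOn hf'd.continuousOn)
  have huc : ContinuousOn (fun z => (f z).im) disk :=
    Complex.continuous_im.comp_continuousOn hfd.continuousOn
  have hu2 : MemLp (fun z => (f z).im) 2 diskMeasure :=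
    MemLp.of_bound (hm huc) B
      (hae fun z hz => (Complex.abs_im_le_norm _).trans (hB z (hsub hz)))
  have hG2 : MemLp (fun z => Complex.I * conj (f' z)) 2 diskMeasure :=
    MemLp.of_bound (hm hGc) C (hae fun z hz => by simpa using hb z hz)
  have hint : ∀ {a η : ℂ → ℝ}, ContinuousOn a disk → IsTestFunction η → ∀ v : ℂ,
      Integrable (fun z => a z * fderiv ℝ η z v) diskMeasure := fun ha hη v =>
    (integrable_mul_of_continuousOn ha
      ((hη.1.continuous_fderiv (by simp)).clm_apply continuous_const)
      (hη.2.1.fderiv_apply (𝕜 := ℝ) v)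
      ((tsupport_fderiv_apply_subset ℝ v).trans hη.2.2)).restrict
  refine ⟨⟨hu2, hG2, fun η hη => ?_⟩, fun η hη => ?_, ?_⟩
  · have i1 : Integrable (fun z => (f z).im • gradient η z) diskMeasure :=
      memLp_one_iff_integrable.1 (MemLp.smul
        ((hη.continuous_gradient.memLp_of_hasCompactSupport (p := 2)
          hη.hasCompactSupport_gradient).restrict _) hu2)
    have i2 : Integrable (fun z => η z • (Complex.I * conj (f' z))) diskMeasure :=
      memLp_one_iff_integrable.1 (MemLp.smul hG2
        ((hη.1.continuous.memLp_of_hasCompactSupport (p := 2) hη.2.1).restrict _))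
    have ibp : ∀ v : ℂ, ∫ z, (f z).im * fderiv ℝ η z v ∂diskMeasure
        = -∫ z, (v * f' z).im * η z ∂diskMeasure := fun v =>
      integral_mul_fderiv_testFunction hη
        (fun z hz => (hasGradientAt_im (hf z hz)).differentiableAt)
        (fun z hz => fderiv_im (hf z hz) v)
        (Complex.continuous_im.comp_continuousOn (continuousOn_const.mul hf'd.continuousOn))
    apply Complex.ext
    · rw [Complex.neg_re, ← Complex.reCLM_apply, ← Complex.reCLM_apply,
        ← Complex.reCLM.integral_comp_comm i1, ← Complex.reCLM.integral_comp_comm i2]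
      simpa [gradient_eq_fderiv, mul_comm] using ibp 1
    · rw [Complex.neg_im, ← Complex.imCLM_apply, ← Complex.imCLM_apply,
        ← Complex.imCLM.integral_comp_comm i1, ← Complex.imCLM.integral_comp_comm i2]
      simpa [gradient_eq_fderiv, mul_comm] using ibp Complex.I
  · have c1 : ContinuousOn (fun z => (f' z).im) disk :=
      Complex.continuous_im.comp_continuousOn hf'd.continuousOn
    have c2 : ContinuousOn (fun z => (f' z).re) disk :=
      Complex.continuous_re.comp_continuousOn hf'd.continuousOn
    -- The gradient has components `im f'` and `re f'`. By the Cauchy–Riemann equations its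
    -- divergence is `im f'' + re (i f'') = 0`.
    have e1 := integral_mul_fderiv_testFunction (a := fun z => (f' z).im) (v := 1) hη
      (fun z hz => (hasGradientAt_im (hf' z hz)).differentiableAt)
      (fun z hz => fderiv_im (hf' z hz) 1)
      (Complex.continuous_im.comp_continuousOn (continuousOn_const.mul hf''c))
    have e2 := integral_mul_fderiv_testFunction (a := fun z => (f' z).re) (v := Complex.I) hη
      (fun z hz => Complex.reCLM.differentiableAt.comp z
        ((hf' z hz).differentiableAt.restrictScalars ℝ))
      (fun z hz => fderiv_re (hf' z hz) Complex.I)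
      (Complex.continuous_re.comp_continuousOn (continuousOn_const.mul hf''c))
    have : ∀ z, inner ℝ (Complex.I * conj (f' z)) (gradient η z)
        = (f' z).im * fderiv ℝ η z 1 + (f' z).re * fderiv ℝ η z Complex.I := fun z => by
      simp [gradient_eq_fderiv, Complex.inner]
      ring
    simp only [this]
    rw [integral_add (hint c1 hη 1) (hint c2 hη Complex.I), e1, e2]
    simp [integral_neg]
  -- The trace is realized by the dilations `f (r z)`, smooth beyond the closed disk since `r < 1`.
  -- The shift by `2` keeps `r` positive already at `k = 0`.
  · set r : ℕ → ℝ := fun k => 1 - 1 / ((k : ℝ) + 2) with hr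
    have hr0 : ∀ k, 0 < r k := fun k => by
      have : (1 : ℝ) / ((k : ℝ) + 2) ≤ 1 / 2 := by gcongr; linarith [k.cast_nonneg (α := ℝ)]
      simp only [hr]; linarith
    have hr1 : ∀ k, r k < 1 := fun k => by
      have : (0 : ℝ) < 1 / ((k : ℝ) + 2) := by positivity
      simp only [hr]; linarith
    have hrl : Tendsto r atTop (𝓝 1) := by
      have h1 : Tendsto (fun k : ℕ => (1 : ℝ) / ((k : ℝ) + 2)) atTop (𝓝 0) :=
        (tendsto_const_nhds (x := (1 : ℝ))).div_atTop
          (tendsto_atTop_add_const_right _ _ tendsto_natCast_atTop_atTop)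
      simpa [hr] using (tendsto_const_nhds (x := (1 : ℝ))).sub h1
    have hrz : ∀ z : ℂ, Tendsto (fun k => (r k : ℂ) * z) atTop (𝓝 z) := fun z => by
      have := (((Complex.continuous_ofReal.tendsto 1).comp hrl).mul_const z)
      simpa [Function.comp_def] using this
    have hrc : ∀ k, ∀ z ∈ Metric.closedBall (0 : ℂ) 1, (r k : ℂ) * z ∈ disk := fun k z hz => by
      rw [mem_closedBall_zero_iff] at hz
      rw [disk, mem_ball_zero_iff, norm_mul, Complex.norm_real, Real.norm_of_nonneg (hr0 k).le]
      calc r k * ‖z‖ ≤ r k * 1 := by gcongr; exact (hr0 k).le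
        _ < 1 := by linarith [hr1 k]
    have hfl : ∀ z ∈ Metric.closedBall (0 : ℂ) 1,
        Tendsto (fun k => f (r k * z)) atTop (𝓝 (f z)) := fun z hz =>
      (hfc z hz).tendsto.comp (tendsto_nhdsWithin_iff.2
        ⟨hrz z, Eventually.of_forall fun k => hsub (hrc k z hz)⟩)
    have hrcont : ∀ k, Continuous fun z : ℂ => (r k : ℂ) * z := fun k => by fun_prop
    have hcirc : ∀ φ, circlePoint φ ∈ Metric.closedBall (0 : ℂ) 1 := fun φ => by
      simp [circlePoint, Complex.norm_exp_ofReal_mul_I]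
    have hgrad : ∀ k, ∀ z ∈ disk, gradient (fun z => (f (r k * z)).im) z
        = Complex.I * conj (f' (r k * z) * r k) := fun k z hz => by
      refine (hasGradientAt_im ?_).gradient
      have h1 : HasDerivAt (fun z : ℂ => (r k : ℂ) * z) (r k) z := by
        simpa using (hasDerivAt_id z).const_mul (r k : ℂ)
      exact (hf _ (hrc k z (hsub hz))).comp z h1
    have hmaps : ∀ k, MapsTo (fun z : ℂ => (r k : ℂ) * z) disk disk := fun k z hz =>
      hrc k z (hsub hz)
    refine ⟨fun k z => (f (r k * z)).im, fun k => ?_, ?_, ?_, ?_⟩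
    · refine ⟨(fun z => (r k : ℂ) * z) ⁻¹' disk, isOpen_disk.preimage (hrcont k), hrc k, ?_⟩
      have h1 : ContDiffOn ℝ ∞ f disk :=
        ((hfd.contDiffOn isOpen_disk (n := ∞)).restrict_scalars ℝ)
      exact (Complex.imCLM.contDiff (n := ∞)).comp_contDiffOn
        (h1.comp (by fun_prop : ContDiff ℝ ∞ fun z : ℂ => (r k : ℂ) * z).contDiffOn
          (fun z hz => hz))
    · refine tendsto_eLpNorm_two_of_bounded (C := B + B) (fun k => hm ?_)
        (fun k => hae fun z hz => ?_) (hae fun z hz => ?_)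
      · exact (huc.comp (hrcont k).continuousOn (hmaps k)).sub huc
      · refine (norm_sub_le _ _).trans (add_le_add ?_ ?_)
        · exact (Complex.abs_im_le_norm _).trans (hB _ (hsub (hmaps k hz)))
        · exact (Complex.abs_im_le_norm _).trans (hB _ (hsub hz))
      · have := ((Complex.continuous_im.tendsto _).comp (hfl z (hsub hz))).sub_const (f z).im
        simpa [Function.comp_def] using this
    · refine tendsto_eLpNorm_two_of_bounded (C := C + C) (fun k => hm ?_)
        (fun k => hae fun z hz => ?_) (hae fun z hz => ?_)
      · refine ContinuousOn.sub (ContinuousOn.congr ?_ (hgrad k)) hGc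
        exact continuousOn_const.mul (Complex.continuous_conj.comp_continuousOn
          ((hf'd.continuousOn.comp (hrcont k).continuousOn (hmaps k)).mul continuousOn_const))
      · rw [hgrad k z hz]
        refine (norm_sub_le _ _).trans (add_le_add ?_ ?_)
        · simp only [norm_mul, Complex.norm_I, one_mul, RCLike.norm_conj, Complex.norm_real,
            Real.norm_of_nonneg (hr0 k).le]
          calc ‖f' (r k * z)‖ * r k ≤ C * 1 :=
                mul_le_mul (hb _ (hmaps k hz)) (hr1 k).le (hr0 k).le hC
            _ = C := mul_one C
        · simpa using hb z hz
      · have h1 : Tendsto (fun k => f' (r k * z)) atTop (𝓝 (f' z)) :=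
          ((hf' z hz).continuousAt.tendsto).comp (hrz z)
        have h2 := (Complex.continuous_ofReal.tendsto 1).comp hrl
        have h3 := (((Complex.continuous_conj.tendsto _).comp (h1.mul h2)).const_mul
          Complex.I).sub_const (Complex.I * conj (f' z))
        simp only [hgrad _ z hz]
        simpa [Function.comp_def] using h3
    · have hae' : ∀ {P : ℝ → Prop}, (∀ φ ∈ Ioc (-Real.pi) Real.pi, P φ) →
          ∀ᵐ φ ∂circleMeasure, P φ := fun hP =>
        (ae_restrict_iff' measurableSet_Ioc).2 (ae_of_all _ hP)
      have hcc : Continuous circlePoint := by unfold circlePoint; fun_prop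
      have hmh : AEStronglyMeasurable h circleMeasure := by
        have h1 : Continuous fun φ => (f (circlePoint φ)).im :=
          Complex.continuous_im.comp (hfc.comp_continuous hcc hcirc)
        exact h1.aestronglyMeasurable.congr (hae' fun φ hφ => (hh φ hφ).symm)
      refine tendsto_eLpNorm_two_of_bounded (C := B + B) (fun k => ?_)
        (fun k => hae' fun φ hφ => ?_) (hae' fun φ hφ => ?_)
      · refine AEStronglyMeasurable.sub (Continuous.aestronglyMeasurable ?_) hmh
        exact Complex.continuous_im.comp (hfd.continuousOn.comp_continuous
          ((hrcont k).comp hcc) fun φ => hrc k _ (hcirc φ))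
      · rw [hh φ hφ]
        refine (norm_sub_le _ _).trans (add_le_add ?_ ?_)
        · exact (Complex.abs_im_le_norm _).trans (hB _ (hsub (hrc k _ (hcirc φ))))
        · exact (Complex.abs_im_le_norm _).trans (hB _ (hcirc φ))
      · rw [hh φ hφ]
        have := ((Complex.continuous_im.tendsto _).comp
          (hfl _ (hcirc φ))).sub_const (f (circlePoint φ)).im
        simpa [Function.comp_def] using this

/-! ### The principal square root on the right half-plane -/

theorem sqrt_mul_self (w : ℂ) : Complex.sqrt w * Complex.sqrt w = w := by
  rw [← sq, Complex.sqrt]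
  exact_mod_cast Complex.cpow_nat_inv_pow w (n := 2) two_ne_zero

/-- The principal square root maps the right half-plane into the sector `|arg| ≤ π / 4`. -/
theorem abs_im_sqrt_le_re {w : ℂ} (hw : 0 ≤ w.re) :
    |(Complex.sqrt w).im| ≤ (Complex.sqrt w).re := by
  have h0 : 0 ≤ (Complex.sqrt w).re := by
    rw [Complex.sqrt, Complex.cpow_inv_two_re]
    positivity
  have h1 := congrArg Complex.re (sqrt_mul_self w)
  rw [Complex.mul_re] at h1
  exact abs_le_of_sq_le_sq (by nlinarith) h0

/-- The branch point `0` is included because the arguments of the two roots reach it at the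
endpoints of the arc; continuity there follows from `‖√w‖ = √‖w‖`. -/
theorem continuousAt_sqrt {w : ℂ} (hw : 0 < w.re ∨ w = 0) : ContinuousAt Complex.sqrt w := by
  rcases hw with hw | rfl
  · exact continuousAt_cpow_const (Or.inl hw)
  · rw [ContinuousAt, Complex.sqrt_zero, tendsto_zero_iff_norm_tendsto_zero]
    have h1 : ∀ w : ℂ, ‖Complex.sqrt w‖ = √‖w‖ := fun w => by
      rw [eq_comm, Real.sqrt_eq_iff_mul_self_eq (norm_nonneg _) (norm_nonneg _), ← norm_mul,
        sqrt_mul_self]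
    simp only [h1]
    exact (Real.continuous_sqrt.comp continuous_norm).tendsto' _ _ (by simp)

theorem hasDerivAt_sqrt {w : ℂ} (hw : 0 < w.re) :
    HasDerivAt Complex.sqrt (1 / (2 * Complex.sqrt w)) w := by
  have hw0 : w ≠ 0 := by rintro rfl; simp at hw
  have h := (hasDerivAt_id w).cpow_const (c := (2⁻¹ : ℂ)) (Or.inl hw)
  refine h.congr_deriv ?_
  have hs : Complex.sqrt w ≠ 0 := fun h => hw0 (by rw [← sqrt_mul_self w, h, zero_mul])
  rw [id, Complex.cpow_sub _ _ hw0, Complex.cpow_one, ← Complex.sqrt]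
  nth_rewrite 2 [← sqrt_mul_self w]
  field_simp

/-! ### The conformal coordinate -/

/-- The right endpoint of the arc. -/
def endRight (α : ℝ) : ℂ := ⟨Real.sin α, Real.cos α⟩

/-- The left endpoint of the arc. -/
def endLeft (α : ℝ) : ℂ := ⟨-Real.sin α, Real.cos α⟩

/-- A holomorphic square root of `1 - z * conj e`, with `e` the right endpoint of the arc. -/
def rootRight (α : ℝ) (z : ℂ) : ℂ := Complex.sqrt (1 - z * conj (endRight α))

/-- A rotated holomorphic square root of `1 - z * conj e`, with `e` the left endpoint of the arc. -/
def rootLeft (α : ℝ) (z : ℂ) : ℂ :=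
  Complex.exp ((α / 2 : ℝ) * Complex.I) * Complex.sqrt (1 - z * conj (endLeft α))

/-- The sum of the two square roots; it has positive real part on the closed disk. -/
def rootSum (α : ℝ) (z : ℂ) : ℂ := rootRight α z + rootLeft α z

/-- A conformal coordinate on the disk that is real on the complement of the arc. -/
def coord (α : ℝ) (z : ℂ) : ℂ := rootLeft α z / rootSum α z

/-- The bounded function `coord * (1 - coord) * coord'`. -/
def coordWeight (α : ℝ) (z : ℂ) : ℂ :=
  Complex.exp (α * Complex.I) * Real.sin α / rootSum α z ^ 4

theorem norm_endRight (α : ℝ) : ‖endRight α‖ = 1 := by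
  rw [Complex.norm_def, Complex.normSq_apply, endRight]
  simp only
  rw [← sq, ← sq, Real.sin_sq_add_cos_sq, Real.sqrt_one]

theorem norm_endLeft (α : ℝ) : ‖endLeft α‖ = 1 := by
  rw [Complex.norm_def, Complex.normSq_apply, endLeft]
  simp only
  rw [← sq, ← sq, neg_sq, Real.sin_sq_add_cos_sq, Real.sqrt_one]

theorem re_one_sub_mul_conj_pos {z e : ℂ} (he : ‖e‖ = 1) (hz : z ∈ disk) :
    0 < (1 - z * conj e).re := by
  have h1 : ‖z * conj e‖ < 1 := by
    rw [norm_mul, RCLike.norm_conj, he, mul_one]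
    simpa [disk] using hz
  have := (Complex.re_le_norm (z * conj e)).trans_lt h1
  rw [Complex.sub_re, Complex.one_re]
  linarith

/-- In the closed unit disk only the point `1` has real part `1`. The alternative is the one under
which the square root is continuous. -/
theorem re_one_sub_mul_conj_pos_or {z e : ℂ} (he : ‖e‖ = 1) (hz : z ∈ Metric.closedBall (0 : ℂ) 1) :
    0 < (1 - z * conj e).re ∨ 1 - z * conj e = 0 := by
  have h1 : ‖z * conj e‖ ≤ 1 := by
    rw [norm_mul, RCLike.norm_conj, he, mul_one]
    simpa using hz
  have h2 := (Complex.re_le_norm (z * conj e)).trans h1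
  rcases h2.lt_or_eq with h | h
  · left
    rw [Complex.sub_re, Complex.one_re]
    linarith
  · right
    have h3 : (z * conj e).re ^ 2 + (z * conj e).im ^ 2 ≤ 1 := by
      rw [sq, sq, ← Complex.normSq_apply, Complex.normSq_eq_norm_sq]
      exact pow_le_one₀ (norm_nonneg _) h1
    have h4 : (z * conj e).im = 0 := by
      rw [h] at h3
      nlinarith [sq_nonneg (z * conj e).im]
    rw [sub_eq_zero]
    apply Complex.ext
    · simp only [h, Complex.one_re]
    · simp only [h4, Complex.one_im]

theorem exp_half_mul_self (α : ℝ) :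
    Complex.exp ((α / 2 : ℝ) * Complex.I) * Complex.exp ((α / 2 : ℝ) * Complex.I)
      = Complex.exp (α * Complex.I) := by
  rw [← Complex.exp_add]
  congr 1
  push_cast
  ring

theorem rootRight_mul_self (α : ℝ) (z : ℂ) :
    rootRight α z * rootRight α z = 1 - z * conj (endRight α) := sqrt_mul_self _

theorem rootLeft_mul_self (α : ℝ) (z : ℂ) :
    rootLeft α z * rootLeft α z
      = Complex.exp (α * Complex.I) * (1 - z * conj (endLeft α)) := by
  rw [rootLeft, mul_mul_mul_comm, exp_half_mul_self, sqrt_mul_self]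

theorem exp_mul_I_eq (α : ℝ) : Complex.exp (α * Complex.I) = ⟨Real.cos α, Real.sin α⟩ := by
  apply Complex.ext
  · simp [Complex.exp_ofReal_mul_I_re]
  · simp [Complex.exp_ofReal_mul_I_im]

/-- The square of `rootLeft * conj rootRight` in coordinates. -/
theorem rootLeft_mul_conj_rootRight_mul_self (α : ℝ) (z : ℂ) :
    (rootLeft α z * conj (rootRight α z)) * (rootLeft α z * conj (rootRight α z))
      = ⟨(1 + ‖z‖ ^ 2) * Real.cos α - 2 * z.im, (1 - ‖z‖ ^ 2) * Real.sin α⟩ := by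
  rw [mul_mul_mul_comm, ← map_mul, rootRight_mul_self, rootLeft_mul_self, exp_mul_I_eq,
    Complex.sq_norm, Complex.normSq_apply, endLeft, endRight]
  have := Real.sin_sq_add_cos_sq α
  apply Complex.ext
  · simp [Complex.mul_re, Complex.mul_im]
    linear_combination (Real.cos α * (z.re ^ 2 + z.im ^ 2) - 2 * z.im) * this
  · simp [Complex.mul_re, Complex.mul_im]
    linear_combination (-Real.sin α * (z.re ^ 2 + z.im ^ 2)) * this

/-- Up to the factor `exp (i α)` this is the determinant of the Möbius map `L² / R²`; it is nonzero,
which gives both injectivity of `coord` and nonvanishing of `coordWeight`. -/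
theorem conj_endRight_sub_conj_endLeft (α : ℝ) :
    conj (endRight α) - conj (endLeft α) = 2 * Real.sin α := by
  apply Complex.ext
  · simp [endRight, endLeft, -Complex.ofReal_sin]
    ring
  · simp [endRight, endLeft, -Complex.ofReal_sin]

variable {α : ℝ}

theorem rootRight_ne_zero {z : ℂ} (hz : z ∈ disk) : rootRight α z ≠ 0 := fun h => by
  have h1 := re_one_sub_mul_conj_pos (norm_endRight α) hz
  rw [← rootRight_mul_self, h] at h1
  simp at h1

theorem rootLeft_ne_zero {z : ℂ} (hz : z ∈ disk) : rootLeft α z ≠ 0 := fun h => by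
  have h1 := re_one_sub_mul_conj_pos (norm_endLeft α) hz
  rw [← sqrt_mul_self (1 - z * conj (endLeft α)),
    (mul_eq_zero.1 h).resolve_left (Complex.exp_ne_zero _)] at h1
  simp at h1

/-- Both principal roots lie in the sector `|arg| ≤ π / 4`, and the rotation by `α / 2 < π / 4`
keeps the left one in the right half-plane. The real part of the sum can vanish only if both roots
do. -/
theorem re_rootSum_pos (hα : 0 < α) (hα' : α < Real.pi / 2) {z : ℂ}
    (hz : z ∈ Metric.closedBall (0 : ℂ) 1) : 0 < (rootSum α z).re := by
  have hR := re_one_sub_mul_conj_pos_or (norm_endRight α) hz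
  have hL := re_one_sub_mul_conj_pos_or (norm_endLeft α) hz
  have hge : ∀ {w : ℂ}, 0 < w.re ∨ w = 0 → 0 ≤ w.re := by
    rintro w (h | rfl)
    · exact h.le
    · simp
  have hR' := abs_im_sqrt_le_re (hge hR)
  have hL' := abs_im_sqrt_le_re (hge hL)
  have hs0 : 0 < Real.sin (α / 2) :=
    Real.sin_pos_of_pos_of_lt_pi (by linarith) (by linarith [Real.pi_pos])
  have hsc : Real.sin (α / 2) < Real.cos (α / 2) := by
    rw [← Real.sin_pi_div_two_sub]
    exact Real.sin_lt_sin_of_lt_of_le_pi_div_two (by linarith) (by linarith) (by linarith)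
  have h1 : (rootLeft α z).re = Real.cos (α / 2) * (Complex.sqrt (1 - z * conj (endLeft α))).re
      - Real.sin (α / 2) * (Complex.sqrt (1 - z * conj (endLeft α))).im := by
    rw [rootLeft, exp_mul_I_eq, Complex.mul_re]
  have hR0 : 0 ≤ (rootRight α z).re := (abs_nonneg _).trans hR'
  set s := Complex.sqrt (1 - z * conj (endLeft α)) with hs
  have hL1 : (Real.cos (α / 2) - Real.sin (α / 2)) * s.re ≤ (rootLeft α z).re := by
    rw [h1]
    nlinarith [(le_abs_self s.im).trans hL']
  have hs1 : 0 ≤ s.re := (abs_nonneg _).trans hL'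
  have hL0 : 0 ≤ (rootLeft α z).re := (mul_nonneg (by linarith) hs1).trans hL1
  rw [rootSum, Complex.add_re]
  by_contra! hcon
  have e1 : (rootRight α z).re = 0 := by linarith
  have e2 : s.re = 0 := by
    have : (Real.cos (α / 2) - Real.sin (α / 2)) * s.re ≤ 0 := by linarith
    nlinarith [mul_nonneg (sub_nonneg.2 hsc.le) hs1]
  have e3 : rootRight α z = 0 := Complex.ext e1 (abs_nonpos_iff.1 (hR'.trans_eq e1))
  have e4 : s = 0 := Complex.ext e2 (abs_nonpos_iff.1 (hL'.trans_eq e2))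
  have e5 := rootRight_mul_self α z
  have e6 := sqrt_mul_self (1 - z * conj (endLeft α))
  rw [e3] at e5
  rw [← hs, e4] at e6
  -- Both roots vanishing would place `z` at two distinct endpoints at once.
  have e7 : z * (conj (endRight α) - conj (endLeft α)) = 0 := by linear_combination e5 - e6
  rcases mul_eq_zero.1 e7 with h | h
  · simp [h] at e5
  · have := congrArg Complex.re h
    simp [endRight, endLeft] at this
    linarith [Real.sin_pos_of_pos_of_lt_pi hα (by linarith)]

theorem rootSum_ne_zero (hα : 0 < α) (hα' : α < Real.pi / 2) {z : ℂ}
    (hz : z ∈ Metric.closedBall (0 : ℂ) 1) : rootSum α z ≠ 0 := fun h => by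
  have := re_rootSum_pos hα hα' hz
  simp [h] at this

theorem continuousOn_rootRight : ContinuousOn (rootRight α) (Metric.closedBall 0 1) :=
  fun z hz => (ContinuousAt.comp (f := fun z : ℂ => 1 - z * conj (endRight α))
    (continuousAt_sqrt (re_one_sub_mul_conj_pos_or (norm_endRight α) hz))
    (by fun_prop)).continuousWithinAt

theorem continuousOn_rootLeft : ContinuousOn (rootLeft α) (Metric.closedBall 0 1) :=
  fun z hz => (continuousAt_const.mul
    (ContinuousAt.comp (f := fun z : ℂ => 1 - z * conj (endLeft α))
      (continuousAt_sqrt (re_one_sub_mul_conj_pos_or (norm_endLeft α) hz))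
      (by fun_prop))).continuousWithinAt

theorem continuousOn_rootSum : ContinuousOn (rootSum α) (Metric.closedBall 0 1) :=
  continuousOn_rootRight.add continuousOn_rootLeft

theorem continuousOn_coord (hα : 0 < α) (hα' : α < Real.pi / 2) :
    ContinuousOn (coord α) (Metric.closedBall 0 1) :=
  continuousOn_rootLeft.div continuousOn_rootSum fun _ hz => rootSum_ne_zero hα hα' hz

theorem continuousOn_coordWeight (hα : 0 < α) (hα' : α < Real.pi / 2) :
    ContinuousOn (coordWeight α) (Metric.closedBall 0 1) :=
  continuousOn_const.div (continuousOn_rootSum.pow 4) fun _ hz =>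
    pow_ne_zero 4 (rootSum_ne_zero hα hα' hz)

theorem coordWeight_ne_zero (hα : 0 < α) (hα' : α < Real.pi / 2) {z : ℂ} (hz : z ∈ disk) :
    coordWeight α z ≠ 0 :=
  div_ne_zero (mul_ne_zero (Complex.exp_ne_zero _)
    (Complex.ofReal_ne_zero.2 (Real.sin_pos_of_pos_of_lt_pi hα (by linarith)).ne'))
    (pow_ne_zero 4 (rootSum_ne_zero hα hα' (Metric.ball_subset_closedBall hz)))

theorem hasDerivAt_one_sub_mul (c z : ℂ) : HasDerivAt (fun z : ℂ => 1 - z * c) (-c) z := by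
  simpa using ((hasDerivAt_id z).mul_const c).const_sub 1

theorem hasDerivAt_rootRight {z : ℂ} (hz : z ∈ disk) :
    HasDerivAt (rootRight α) (-conj (endRight α) / (2 * rootRight α z)) z := by
  refine ((hasDerivAt_sqrt (re_one_sub_mul_conj_pos (norm_endRight α) hz)).comp z
    (hasDerivAt_one_sub_mul _ z)).congr_deriv ?_
  rw [← rootRight]
  ring

theorem hasDerivAt_rootLeft {z : ℂ} (hz : z ∈ disk) :
    HasDerivAt (rootLeft α)
      (-Complex.exp (α * Complex.I) * conj (endLeft α) / (2 * rootLeft α z)) z := by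
  refine (((hasDerivAt_sqrt (re_one_sub_mul_conj_pos (norm_endLeft α) hz)).comp z
    (hasDerivAt_one_sub_mul _ z)).const_mul _).congr_deriv ?_
  have h := rootLeft_ne_zero (α := α) hz
  rw [rootLeft] at h ⊢
  obtain ⟨h1, h2⟩ := mul_ne_zero_iff.1 h
  rw [← exp_half_mul_self α]
  generalize Complex.exp ((α / 2 : ℝ) * Complex.I) = ε at *
  field_simp

/-- Since `p (1 - p) = L R / S²` and `p' = (L' R - L R') / S²`, the numerator of the product is `(L
L') R² - L² (R R')`. The singular factors `1 / L` and `1 / R` of the derivatives cancel, and what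
remains is the constant `exp (i α) sin α`. -/
theorem hasDerivAt_coord (hα : 0 < α) (hα' : α < Real.pi / 2) {z : ℂ} (hz : z ∈ disk) :
    ∃ p', HasDerivAt (coord α) p' z ∧ coord α z * (1 - coord α z) * p' = coordWeight α z := by
  have hS := rootSum_ne_zero hα hα' (Metric.ball_subset_closedBall hz)
  have hR := rootRight_ne_zero (α := α) hz
  have hL := rootLeft_ne_zero (α := α) hz
  refine ⟨_, (hasDerivAt_rootLeft hz).div
    (show HasDerivAt (rootSum α) _ z from
      (hasDerivAt_rootRight hz).add (hasDerivAt_rootLeft hz)) hS, ?_⟩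
  have e1 := rootRight_mul_self α z
  have e2 := rootLeft_mul_self α z
  have e3 := conj_endRight_sub_conj_endLeft α
  have e4 : 1 - coord α z = rootRight α z / rootSum α z := by
    rw [coord, eq_div_iff hS, sub_mul, div_mul_cancel₀ _ hS, rootSum]
    ring
  rw [e4, coord, coordWeight]
  have e5 : rootSum α z = rootRight α z + rootLeft α z := rfl
  generalize rootSum α z = S at *
  generalize rootRight α z = A at *
  generalize rootLeft α z = E at *
  field_simp
  rw [e5]
  generalize Complex.exp (α * Complex.I) = ε at *
  linear_combination (-ε * conj (endLeft α)) * e1 + conj (endRight α) * e2 + ε * e3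

/-! ### Boundary values and injectivity of the coordinate -/

/-- Points of the circle off the arc have imaginary part less than `cos α`. -/
theorem sin_lt_cos_of_notMem_arc (hα : 0 < α) (hα' : α < Real.pi / 2) {φ : ℝ}
    (hφ : φ ∈ Ioc (-Real.pi) Real.pi) (h : φ ∉ arc α) : Real.sin φ < Real.cos α := by
  rw [arc, mem_Icc, not_and_or, not_le, not_le] at h
  obtain ⟨h1, h2⟩ := hφ
  rcases h with h | h
  · rw [← Real.cos_pi_div_two_sub]
    rcases le_or_gt (Real.pi / 2 - φ) Real.pi with h3 | h3
    · exact Real.cos_lt_cos_of_nonneg_of_le_pi hα.le h3 (by linarith)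
    · exact (Real.cos_nonpos_of_pi_div_two_le_of_le (by linarith) (by linarith)).trans_lt
        (Real.cos_pos_of_mem_Ioo ⟨by linarith, hα'⟩)
  · rw [← Real.cos_sub_pi_div_two]
    exact Real.cos_lt_cos_of_nonneg_of_le_pi hα.le (by linarith) (by linarith)

theorem im_eq_zero_of_mul_self {q : ℂ} {x : ℝ} (hx : 0 < x) (h : q * q = ⟨x, 0⟩) : q.im = 0 := by
  have h1 := congrArg Complex.re h
  have h2 := congrArg Complex.im h
  simp only [Complex.mul_re, Complex.mul_im] at h1 h2
  rcases mul_eq_zero.1 (show q.re * q.im = 0 by linarith) with h3 | h3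
  · rw [h3] at h1
    nlinarith [sq_nonneg q.im]
  · exact h3

/-- On the circle `(L * conj R)²` is the real number `2 (cos α - sin φ)`, positive off the arc. So
`L * conj R` is real, and so is `L * conj (R + L)`. -/
theorem coord_im_eq_zero (hα : 0 < α) (hα' : α < Real.pi / 2) {φ : ℝ}
    (hφ : φ ∈ Ioc (-Real.pi) Real.pi) (h : φ ∉ arc α) : (coord α (circlePoint φ)).im = 0 := by
  have hn : ‖circlePoint φ‖ = 1 := Complex.norm_exp_ofReal_mul_I φ
  have him : (circlePoint φ).im = Real.sin φ := Complex.exp_ofReal_mul_I_im φ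
  have h1 := rootLeft_mul_conj_rootRight_mul_self α (circlePoint φ)
  rw [hn, him, one_pow, sub_self, zero_mul] at h1
  have h2 := im_eq_zero_of_mul_self
    (by linarith [sin_lt_cos_of_notMem_arc hα hα' hφ h]) h1
  rw [Complex.mul_im, Complex.conj_re, Complex.conj_im] at h2
  rw [coord, Complex.div_im, rootSum, Complex.add_re, Complex.add_im]
  rw [← sub_div, div_eq_zero_iff]
  left
  linarith

theorem coord_ratio_eq {z w : ℂ} (hα : 0 < α) (hα' : α < Real.pi / 2) (hz : z ∈ disk)
    (hw : w ∈ disk) (h : coord α z = coord α w) :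
    rootLeft α z * rootRight α w = rootLeft α w * rootRight α z := by
  rw [coord, coord, div_eq_div_iff (rootSum_ne_zero hα hα' (Metric.ball_subset_closedBall hz))
    (rootSum_ne_zero hα hα' (Metric.ball_subset_closedBall hw)), rootSum, rootSum] at h
  linear_combination h

/-- The coordinate determines `L / R`, hence the Möbius map `L² / R²`, which is injective. -/
theorem coord_injOn (hα : 0 < α) (hα' : α < Real.pi / 2) : InjOn (coord α) disk := by
  intro z hz w hw h
  have h1 := coord_ratio_eq hα hα' hz hw h
  have h2 : (rootLeft α z * rootLeft α z) * (rootRight α w * rootRight α w)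
      = (rootLeft α w * rootLeft α w) * (rootRight α z * rootRight α z) := by
    linear_combination (rootLeft α z * rootRight α w + rootLeft α w * rootRight α z) * h1
  simp only [rootLeft_mul_self, rootRight_mul_self] at h2
  have h3 : Complex.exp (α * Complex.I) * ((z - w) * (2 * Real.sin α)) = 0 := by
    have e3 := conj_endRight_sub_conj_endLeft α
    rw [← e3]
    linear_combination h2
  have hs : (2 * Real.sin α : ℂ) ≠ 0 := mul_ne_zero two_ne_zero
    (Complex.ofReal_ne_zero.2 (Real.sin_pos_of_pos_of_lt_pi hα (by linarith)).ne')
  have h4 := (mul_eq_zero.1 h3).resolve_left (Complex.exp_ne_zero _)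
  exact sub_eq_zero.1 ((mul_eq_zero.1 h4).resolve_right hs)

/-- Conjugate values of `coord` would give conjugate values of `L² / R²`, but this map takes the
disk into the open upper half-plane. -/
theorem coord_ne_conj_coord (hα : 0 < α) (hα' : α < Real.pi / 2) {z w : ℂ} (hz : z ∈ disk)
    (hw : w ∈ disk) : coord α z ≠ conj (coord α w) := by
  intro h
  have hS := rootSum_ne_zero hα hα' (Metric.ball_subset_closedBall hz)
  have hS' := rootSum_ne_zero hα hα' (Metric.ball_subset_closedBall hw)
  rw [coord, coord, map_div₀, div_eq_div_iff hS
    (by simpa using hS'), rootSum, rootSum, map_add] at h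
  have h1 : rootLeft α z * conj (rootRight α w) = conj (rootLeft α w) * rootRight α z := by
    linear_combination h
  set q := rootLeft α z * conj (rootRight α z) with hq
  set q' := rootLeft α w * conj (rootRight α w) with hq'
  have h2 : q * (rootRight α w * conj (rootRight α w))
      = conj q' * (rootRight α z * conj (rootRight α z)) := by
    rw [hq, hq', map_mul, Complex.conj_conj]
    linear_combination (rootRight α w * conj (rootRight α z)) * h1
  -- Squaring removes the choice of branch: the imaginary part of `q * q` is explicit and positive
  -- on the disk.
  have h3 : (q * q) * ((‖rootRight α w‖ ^ 4 : ℝ) : ℂ)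
      = conj (q' * q') * ((‖rootRight α z‖ ^ 4 : ℝ) : ℂ) := by
    rw [Complex.mul_conj, Complex.mul_conj, Complex.normSq_eq_norm_sq,
      Complex.normSq_eq_norm_sq] at h2
    push_cast at h2 ⊢
    rw [map_mul]
    linear_combination (q * (‖rootRight α w‖ : ℂ) ^ 2 + conj q' * (‖rootRight α z‖ : ℂ) ^ 2) * h2
  rw [hq, hq', rootLeft_mul_conj_rootRight_mul_self, rootLeft_mul_conj_rootRight_mul_self] at h3
  have h4 := congrArg Complex.im h3
  rw [Complex.im_mul_ofReal, Complex.im_mul_ofReal, Complex.conj_im] at h4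
  simp only at h4
  have hpos : ∀ {u : ℂ}, u ∈ disk → 0 < (1 - ‖u‖ ^ 2) * Real.sin α := fun {u} hu => by
    have hu1 : ‖u‖ < 1 := by simpa [disk] using hu
    refine mul_pos ?_ (Real.sin_pos_of_pos_of_lt_pi hα (by linarith))
    nlinarith [norm_nonneg u]
  have e1 := mul_pos (hpos hz) (pow_pos (norm_pos_iff.2 (rootRight_ne_zero (α := α) hw)) 4)
  have e2 := mul_pos (hpos hw) (pow_pos (norm_pos_iff.2 (rootRight_ne_zero (α := α) hz)) 4)
  linarith

/-! ### Test solutions with bounded gradient -/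

/-- A holomorphic function with derivative `coord ^ m * coordWeight`. -/
def potential (α : ℝ) (m : ℕ) (z : ℂ) : ℂ :=
  coord α z ^ (m + 2) / (m + 2) - coord α z ^ (m + 3) / (m + 3)

/-- The gradient of the imaginary part of `potential`. It is bounded on the disk, also near the
endpoints of the arc, so that its products with `L²` functions are integrable. -/
def potentialGrad (α : ℝ) (m : ℕ) (z : ℂ) : ℂ :=
  Complex.I * conj (coord α z ^ m * coordWeight α z)

/-- The boundary values of the imaginary part of `potential`. -/
def potentialTrace (α : ℝ) (m : ℕ) (φ : ℝ) : ℝ := (potential α m (circlePoint φ)).im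

theorem hasDerivAt_potential (hα : 0 < α) (hα' : α < Real.pi / 2) (m : ℕ) {z : ℂ}
    (hz : z ∈ disk) : HasDerivAt (potential α m) (coord α z ^ m * coordWeight α z) z := by
  obtain ⟨p', hp, hK⟩ := hasDerivAt_coord hα hα' hz
  refine (((hp.pow (m + 2)).div_const _).sub ((hp.pow (m + 3)).div_const _)).congr_deriv ?_
  have h2 : (m + 2 : ℂ) ≠ 0 := by exact_mod_cast (Nat.succ_ne_zero (m + 1))
  have h3 : (m + 3 : ℂ) ≠ 0 := by exact_mod_cast (Nat.succ_ne_zero (m + 2))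
  rw [← hK, Nat.add_sub_assoc (by norm_num), Nat.add_sub_assoc (by norm_num)]
  push_cast
  field_simp
  ring

theorem continuousOn_potential (hα : 0 < α) (hα' : α < Real.pi / 2) (m : ℕ) :
    ContinuousOn (potential α m) (Metric.closedBall 0 1) :=
  (((continuousOn_coord hα hα').pow _).div_const _).sub
    (((continuousOn_coord hα hα').pow _).div_const _)

theorem potentialTrace_eq_zero (hα : 0 < α) (hα' : α < Real.pi / 2) (m : ℕ) {φ : ℝ}
    (hφ : φ ∈ Ioc (-Real.pi) Real.pi) (h : φ ∉ arc α) : potentialTrace α m φ = 0 := by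
  have h1 := Complex.conj_eq_iff_im.2 (coord_im_eq_zero hα hα' hφ h)
  rw [potentialTrace, ← Complex.conj_eq_iff_im, potential]
  simp [h1, map_ofNat]

theorem zeroExt_potentialTrace (hα : 0 < α) (hα' : α < Real.pi / 2) (m : ℕ) {φ : ℝ}
    (hφ : φ ∈ Ioc (-Real.pi) Real.pi) :
    zeroExt α (potentialTrace α m) φ = potentialTrace α m φ := by
  by_cases h : φ ∈ arc α
  · exact indicator_of_mem h _
  · rw [zeroExt, indicator_of_notMem h, potentialTrace_eq_zero hα hα' m hφ h]

theorem isDirichletSolution_potential (hα : 0 < α) (hα' : α < Real.pi / 2) (m : ℕ) :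
    IsDirichletSolution (zeroExt α (potentialTrace α m)) (fun z => (potential α m z).im)
      (potentialGrad α m) := by
  obtain ⟨C, hC⟩ := (isCompact_closedBall (0 : ℂ) 1).exists_bound_of_continuousOn
    (((continuousOn_coord hα hα').pow m).mul (continuousOn_coordWeight hα hα'))
  exact isDirichletSolution_im (fun z hz => hasDerivAt_potential hα hα' m hz)
    (continuousOn_potential hα hα' m) (fun z hz => hC z (Metric.ball_subset_closedBall hz))
    (fun φ hφ => zeroExt_potentialTrace hα hα' m hφ)

theorem memHHalf_potentialTrace (hα : 0 < α) (hα' : α < Real.pi / 2) (m : ℕ) :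
    MemHHalf (zeroExt α (potentialTrace α m)) := by
  have hs := isDirichletSolution_potential hα hα' m
  refine ⟨?_, _, _, hs.memH1, hs.trace⟩
  have hcc : Continuous circlePoint := by unfold circlePoint; fun_prop
  have hcirc : ∀ φ, circlePoint φ ∈ Metric.closedBall (0 : ℂ) 1 := fun φ => by
    simp [circlePoint, Complex.norm_exp_ofReal_mul_I]
  obtain ⟨B, hB⟩ := (isCompact_closedBall (0 : ℂ) 1).exists_bound_of_continuousOn
    (continuousOn_potential hα hα' m)
  have h1 : MemLp (potentialTrace α m) 2 circleMeasure :=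
    MemLp.of_bound (Complex.continuous_im.comp ((continuousOn_potential hα hα' m).comp_continuous
      hcc hcirc)).aestronglyMeasurable B
      (ae_of_all _ fun φ => (Complex.abs_im_le_norm _).trans (hB _ (hcirc φ)))
  exact h1.ae_eq ((ae_restrict_iff' measurableSet_Ioc).2 (ae_of_all _ fun φ hφ =>
    (zeroExt_potentialTrace hα hα' m hφ).symm))

/-- Independent exponents `m` and `n` supply the mixed moments in `p` and `conj p`; the weight is
the same for all of them. -/
theorem inner_potentialGrad (m n : ℕ) (z : ℂ) :
    inner ℝ (potentialGrad α m z) (potentialGrad α n z)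
      = Complex.normSq (coordWeight α z) * (coord α z ^ m * conj (coord α z) ^ n).re := by
  rw [potentialGrad, potentialGrad, Complex.inner]
  have : conj (Complex.I * conj (coord α z ^ m * coordWeight α z))
      * (Complex.I * conj (coord α z ^ n * coordWeight α z))
      = (Complex.normSq (coordWeight α z) : ℂ) * (coord α z ^ m * conj (coord α z) ^ n) := by
    rw [← Complex.mul_conj]
    simp only [map_mul, map_pow, Complex.conj_conj, Complex.conj_I]
    linear_combination (-coord α z ^ m * coordWeight α z * conj (coord α z) ^ n
      * conj (coordWeight α z)) * Complex.I_mul_I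
  rw [mul_comm] at this
  rw [this, Complex.re_ofReal_mul]

theorem integrable_mul_of_continuousOn_closedBall {γ k : ℂ → ℝ} (hγ : MemLp γ 2 diskMeasure)
    (hk : ContinuousOn k (Metric.closedBall 0 1)) :
    Integrable (fun z => γ z * k z) diskMeasure := by
  obtain ⟨B, hB⟩ := (isCompact_closedBall (0 : ℂ) 1).exists_bound_of_continuousOn hk
  refine (hγ.integrable (by norm_num)).mul_bdd (c := B)
    ((hk.mono Metric.ball_subset_closedBall).aestronglyMeasurable measurableSet_disk) ?_
  exact (ae_restrict_iff' measurableSet_disk).2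
    (ae_of_all _ fun z hz => hB z (Metric.ball_subset_closedBall hz))

theorem continuousOn_inner_potentialGrad (hα : 0 < α) (hα' : α < Real.pi / 2) (m n : ℕ) :
    ContinuousOn (fun z => inner ℝ (potentialGrad α m z) (potentialGrad α n z))
      (Metric.closedBall 0 1) := by
  have h : ∀ m, ContinuousOn (potentialGrad α m) (Metric.closedBall 0 1) := fun m =>
    continuousOn_const.mul (Complex.continuous_conj.comp_continuousOn
      (((continuousOn_coord hα hα').pow m).mul (continuousOn_coordWeight hα hα')))
  exact (h m).inner (𝕜 := ℝ) (h n)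

theorem hasLinearizedDtNValue_potentialTrace (hα : 0 < α) (hα' : α < Real.pi / 2) {γ : ℂ → ℝ}
    (hγ : MemLp γ 2 diskMeasure) (m n : ℕ) :
    HasLinearizedDtNValue α γ (potentialTrace α m) (potentialTrace α n)
      (∫ z, γ z * inner ℝ (potentialGrad α m z) (potentialGrad α n z) ∂diskMeasure) :=
  ⟨memHHalf_potentialTrace hα hα' m, memHHalf_potentialTrace hα hα' n, _, _, _, _,
    isDirichletSolution_potential hα hα' m, isDirichletSolution_potential hα hα' n,
    integrable_mul_of_continuousOn_closedBall hγ (continuousOn_inner_potentialGrad hα hα' m n),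
    rfl⟩

/-! ### Vanishing moments -/

open scoped BoundedContinuousFunction

/-- An integrable function that is orthogonal to an algebra of bounded continuous functions
separating points vanishes almost everywhere. -/
theorem ae_eq_zero_of_integral_mul_eq_zero {E : Type*} [TopologicalSpace E] [PolishSpace E]
    [MeasurableSpace E] [BorelSpace E] {ν : Measure E} {g : E → ℝ} (hg : Integrable g ν)
    {A : StarSubalgebra ℝ (E →ᵇ ℝ)}
    (hA : (A.map (BoundedContinuousFunction.toContinuousMapStarₐ ℝ)).SeparatesPoints)
    (h : ∀ f ∈ A, ∫ x, g x * f x ∂ν = 0) : g =ᵐ[ν] 0 := by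
  have : IsFiniteMeasure (ν.withDensity fun x => ENNReal.ofReal (g x)) :=
    isFiniteMeasure_withDensity_ofReal hg.2
  have : IsFiniteMeasure (ν.withDensity fun x => ENNReal.ofReal (-g x)) :=
    isFiniteMeasure_withDensity_ofReal hg.neg.2
  have hm1 : AEMeasurable (fun x => ENNReal.ofReal (g x)) ν := hg.1.aemeasurable.ennreal_ofReal
  have hm2 : AEMeasurable (fun x => ENNReal.ofReal (-g x)) ν :=
    hg.neg.1.aemeasurable.ennreal_ofReal
  -- The positive and negative parts of `g` are densities of two finite measures with equal
  -- integrals over a separating algebra, so the measures agree. Equal parts force `g = 0`.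
  have heq : ν.withDensity (fun x => ENNReal.ofReal (g x))
      = ν.withDensity fun x => ENNReal.ofReal (-g x) := by
    refine ext_of_forall_mem_subalgebra_integral_eq_of_polish hA fun f hf => ?_
    rw [integral_withDensity_eq_integral_toReal_smul₀ hm1 (ae_of_all _ fun _ => by simp),
      integral_withDensity_eq_integral_toReal_smul₀ hm2 (ae_of_all _ fun _ => by simp),
      ← sub_eq_zero]
    have hb : ∀ {k : E → ℝ}, Integrable k ν →
        Integrable (fun x => (ENNReal.ofReal (k x)).toReal • f x) ν := fun hk => by
      refine Integrable.mul_bdd (c := ‖f‖) ?_ f.continuous.aestronglyMeasurable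
        (ae_of_all _ f.norm_coe_le_norm)
      simpa only [ENNReal.toReal_ofReal'] using hk.pos_part
    rw [← integral_sub (hb hg) (hb (k := fun x => -g x) hg.neg), ← h f hf]
    congr 1
    ext x
    simp only [ENNReal.toReal_ofReal', smul_eq_mul]
    rw [← sub_mul]
    congr 1
    rcases le_total 0 (g x) with h0 | h0
    · rw [max_eq_left h0, max_eq_right (by linarith), sub_zero]
    · rw [max_eq_right h0, max_eq_left (by linarith)]
      ring
  have hfin : ∫⁻ x, ENNReal.ofReal (g x) ∂ν ≠ ⊤ := hg.lintegral_lt_top.ne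
  filter_upwards [(withDensity_eq_iff hm1 hm2 hfin).1 heq] with x hx
  rcases le_total 0 (g x) with h0 | h0
  · rw [ENNReal.ofReal_of_nonpos (by linarith : -g x ≤ 0), ENNReal.ofReal_eq_zero] at hx
    exact le_antisymm hx h0
  · rw [ENNReal.ofReal_of_nonpos h0, eq_comm, ENNReal.ofReal_eq_zero] at hx
    exact le_antisymm h0 (neg_nonpos.1 hx)

/-- Monomials in `re p` and `|p|²` are combinations of the real parts of `p ^ m * conj p ^ n`. -/
theorem re_pow_mul_normSq_pow (p : ℂ) (j k : ℕ) :
    p.re ^ j * Complex.normSq p ^ k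
      = ∑ i ∈ Finset.range (j + 1),
        (j.choose i / 2 ^ j : ℝ) * (p ^ (i + k) * conj p ^ (j - i + k)).re := by
  have h1 : ((p.re ^ j * Complex.normSq p ^ k : ℝ) : ℂ)
      = ∑ i ∈ Finset.range (j + 1),
        ((j.choose i / 2 ^ j : ℝ) : ℂ) * (p ^ (i + k) * conj p ^ (j - i + k)) := by
    push_cast
    rw [Complex.re_eq_add_conj, ← Complex.mul_conj, div_pow, add_pow, Finset.sum_div,
      Finset.sum_mul]
    refine Finset.sum_congr rfl fun i _ => ?_
    rw [mul_pow, pow_add, pow_add]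
    ring
  have h2 := congrArg Complex.re h1
  rw [Complex.ofReal_re, Complex.re_sum] at h2
  rw [h2]
  exact Finset.sum_congr rfl fun i _ => Complex.re_ofReal_mul _ _

instance : PolishSpace disk := isOpen_disk.polishSpace

/-- A bounded continuous function on the disk, from a continuous function on the closed disk. -/
def diskRestrict (k : ℂ → ℝ) (hk : ContinuousOn k (Metric.closedBall 0 1)) : disk →ᵇ ℝ :=
  BoundedContinuousFunction.ofNormedAddCommGroup (fun z : disk => k z)
    (hk.mono Metric.ball_subset_closedBall).domRestrict
    ((isCompact_closedBall (0 : ℂ) 1).exists_bound_of_continuousOn hk).choose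
    fun z => ((isCompact_closedBall (0 : ℂ) 1).exists_bound_of_continuousOn hk).choose_spec z
      (Metric.ball_subset_closedBall z.2)

theorem diskRestrict_apply {k : ℂ → ℝ} (hk : ContinuousOn k (Metric.closedBall 0 1)) (z : disk) :
    diskRestrict k hk z = k z := rfl

theorem integrable_comap_subtype_val {g : ℂ → ℝ} (hg : Integrable g diskMeasure) :
    Integrable (fun z : disk => g z) (volume.comap Subtype.val) := by
  rw [diskMeasure, ← map_comap_subtype_coe measurableSet_disk] at hg
  exact ((MeasurableEmbedding.subtype_coe measurableSet_disk).integrable_map_iff).1 hg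

/-- A function on the disk whose moments against `re (coord ^ m * conj coord ^ n)` vanish is zero
almost everywhere. -/
theorem ae_eq_zero_of_moments {g : ℂ → ℝ} (hα : 0 < α) (hα' : α < Real.pi / 2)
    (hg : Integrable g diskMeasure)
    (hgm : ∀ m n : ℕ, ∫ z, g z * (coord α z ^ m * conj (coord α z) ^ n).re ∂diskMeasure = 0) :
    ∀ᵐ z ∂diskMeasure, g z = 0 := by
  have hp := continuousOn_coord hα hα'
  set X : disk →ᵇ ℝ := diskRestrict (fun z => (coord α z).re)
    (Complex.continuous_re.comp_continuousOn hp) with hX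
  set Y : disk →ᵇ ℝ := diskRestrict (fun z => Complex.normSq (coord α z))
    (Complex.continuous_normSq.comp_continuousOn hp) with hY
  let A : StarSubalgebra ℝ (disk →ᵇ ℝ) :=
    { Algebra.adjoin ℝ {X, Y} with
      star_mem' := fun {a} ha => by
        have : star a = a := by ext x; simp
        rwa [this] }
  have hXA : X ∈ A := Algebra.subset_adjoin (by simp)
  have hYA : Y ∈ A := Algebra.subset_adjoin (by simp)
  have hgi := integrable_comap_subtype_val hg
  have hgf : ∀ f : disk →ᵇ ℝ, Integrable (fun z : disk => g z * f z) (volume.comap Subtype.val) :=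
    fun f => hgi.mul_bdd (c := ‖f‖) f.continuous.aestronglyMeasurable
      (ae_of_all _ f.norm_coe_le_norm)
  have hmon : ∀ j k : ℕ, ∫ z : disk, g z * (X ^ j * Y ^ k) z ∂(volume.comap Subtype.val) = 0 := by
    intro j k
    have e1 : ∀ z : disk, g z * (X ^ j * Y ^ k) z = (fun z : ℂ => g z *
        ((coord α z).re ^ j * Complex.normSq (coord α z) ^ k)) z := fun z => by
      simp [hX, hY, diskRestrict_apply]
    simp only [e1]
    rw [integral_subtype_comap measurableSet_disk (fun z : ℂ => g z *
        ((coord α z).re ^ j * Complex.normSq (coord α z) ^ k)), ← diskMeasure]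
    simp only [re_pow_mul_normSq_pow, Finset.mul_sum]
    rw [integral_finsetSum]
    · refine Finset.sum_eq_zero fun i _ => ?_
      simp only [mul_left_comm (g _)]
      rw [integral_const_mul, hgm, mul_zero]
    · intro i _
      have hc : ContinuousOn (fun z => (j.choose i / 2 ^ j : ℝ) *
          (coord α z ^ (i + k) * conj (coord α z) ^ (j - i + k)).re) (Metric.closedBall 0 1) :=
        continuousOn_const.mul (Complex.continuous_re.comp_continuousOn
          ((hp.pow _).mul ((Complex.continuous_conj.comp_continuousOn hp).pow _)))
      obtain ⟨B, hB⟩ := (isCompact_closedBall (0 : ℂ) 1).exists_bound_of_continuousOn hc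
      exact hg.mul_bdd (c := B)
        ((hc.mono Metric.ball_subset_closedBall).aestronglyMeasurable measurableSet_disk)
        ((ae_restrict_iff' measurableSet_disk).2
          (ae_of_all _ fun z hz => hB z (Metric.ball_subset_closedBall hz)))
  have hA0 : ∀ f ∈ A, ∫ z : disk, g z * f z ∂(volume.comap Subtype.val) = 0 := by
    intro f hf
    -- The generated algebra is the linear span of the monomials `X ^ j * Y ^ k`, which reduces the
    -- claim to `hmon`.
    have hf' : f ∈ Submodule.span ℝ (Submonoid.closure {X, Y} : Set (disk →ᵇ ℝ)) := by
      rw [← Algebra.adjoin_eq_span]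
      exact hf
    clear hf
    induction hf' using Submodule.span_induction with
    | mem f hf =>
      obtain ⟨j, k, rfl⟩ := (Submonoid.mem_closure_pair _ _ _).1 hf
      exact hmon j k
    | zero => simp
    | add f₁ f₂ hf₁ hf₂ h₁ h₂ =>
      simp only [BoundedContinuousFunction.coe_add, Pi.add_apply, mul_add]
      rw [integral_add (hgf f₁) (hgf f₂), h₁, h₂, add_zero]
    | smul c f hf₁ h₁ =>
      simp only [BoundedContinuousFunction.coe_smul, smul_eq_mul, mul_left_comm (g _)]
      rw [integral_const_mul, h₁, mul_zero]
  have hsep : (A.map (BoundedContinuousFunction.toContinuousMapStarₐ ℝ)).SeparatesPoints := by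
    intro z w hzw
    by_contra! hcon
    have hall : ∀ f ∈ A, f z = f w := fun f hf => hcon f ⟨_, ⟨f, hf, rfl⟩, rfl⟩
    have h1 : (coord α z).re = (coord α w).re := hall X hXA
    have h2 : Complex.normSq (coord α z) = Complex.normSq (coord α w) := hall Y hYA
    -- Equal real parts and moduli leave two cases, equal or conjugate values of `coord`.
    rw [Complex.normSq_apply, Complex.normSq_apply, h1, add_right_inj, mul_self_eq_mul_self_iff]
      at h2
    rcases h2 with h2 | h2
    · exact hzw (Subtype.ext (coord_injOn hα hα' z.2 w.2 (Complex.ext h1 h2)))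
    · exact coord_ne_conj_coord hα hα' z.2 w.2 (Complex.ext h1 (by simpa using h2))
  have hz := ae_eq_zero_of_integral_mul_eq_zero hgi hsep hA0
  rw [diskMeasure, ← map_comap_subtype_coe measurableSet_disk,
    (MeasurableEmbedding.subtype_coe measurableSet_disk).ae_map_iff]
  exact hz

end LinearizedEIT

end

/-! ### Uniqueness -/

theorem mainTheorem3 (α : ℝ) (hα : 0 < α) (hα' : α < Real.pi / 2) (γ₁ γ₂ : ℂ → ℝ)
    (hγ₁ : MeasureTheory.MemLp γ₁ 2 LinearizedEIT.diskMeasure)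
    (hγ₂ : MeasureTheory.MemLp γ₂ 2 LinearizedEIT.diskMeasure)
    (hv₁ : LinearizedEIT.VanishesNearEndpoints α γ₁)
    (hv₂ : LinearizedEIT.VanishesNearEndpoints α γ₂)
    (hdata : ∀ (f g : ℝ → ℝ) (c₁ c₂ : ℝ),
      LinearizedEIT.HasLinearizedDtNValue α γ₁ f g c₁ →
      LinearizedEIT.HasLinearizedDtNValue α γ₂ f g c₂ → c₁ = c₂) :
    ∀ᵐ z ∂LinearizedEIT.diskMeasure, γ₁ z = γ₂ z := by
  open LinearizedEIT MeasureTheory in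
  have hK : ContinuousOn (fun z => Complex.normSq (coordWeight α z)) (Metric.closedBall 0 1) :=
    Complex.continuous_normSq.comp_continuousOn (continuousOn_coordWeight hα hα')
  -- The weight `|K|²` is absorbed into the function whose moments vanish and is divided out at the
  -- end.
  have hm := ae_eq_zero_of_moments hα hα'
    (integrable_mul_of_continuousOn_closedBall (hγ₁.sub hγ₂) hK) fun m n => by
      have h1 := hdata _ _ _ _ (hasLinearizedDtNValue_potentialTrace hα hα' hγ₁ m n)
        (hasLinearizedDtNValue_potentialTrace hα hα' hγ₂ m n)
      rw [← sub_eq_zero, ← integral_sub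
        (integrable_mul_of_continuousOn_closedBall hγ₁
          (continuousOn_inner_potentialGrad hα hα' m n))
        (integrable_mul_of_continuousOn_closedBall hγ₂
          (continuousOn_inner_potentialGrad hα hα' m n))] at h1
      rw [← h1]
      congr 1
      ext z
      rw [inner_potentialGrad, Pi.sub_apply]
      ring
  filter_upwards [hm, (ae_restrict_iff' measurableSet_disk).2
    (ae_of_all _ fun z hz => coordWeight_ne_zero hα hα' hz)] with z h1 h2
  exact sub_eq_zero.1 ((mul_eq_zero.1 h1).resolve_right fun h => h2 (Complex.normSq_eq_zero.1 h))
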